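/- Throughout, words have distinct letters. The empty word and all one-letter words are both André I and André II words. A word of length at least $2$, written $\tau\, m\, \tau'$ with $m$ its minimum letter, is an André I word (resp. André II word) if $\tau$ and $\tau'$ are both André I words (resp. André II words) and the maximum (resp. minimum) letter of $\tau\tau'$ lies in $\tau'$. A permutation $\sigma=\sigma_1\cdots\sigma_n$ of $[n]=\{1,\dots,n\}$ is André I (resp. André II) if this word is. It is simsun if $\sigma_n=n$ and, for every $0\le k\le n$, the word obtained from $\sigma_1\cdots\sigma_n$ by deleting all letters greater than $k$ has no three consecutive letters $a>b>c$. The increasing binary tree of a word is empty if the word is empty; otherwise, if the word is $\alpha\, m\, \beta$ with $m$ its minimum letter, the tree has root $m$ and its left and right subtrees are the trees of $\alpha$ and $\beta$. The shape of $\sigma$ is the unlabeled binary tree (with left and right children distinguished) underlying the tree of $\sigma_1\cdots\sigma_n$. Let $\mathrm{ides}(\sigma)$ be the number of $i$ with $1\le i<n$ and $\sigma^{-1}(i)>\sigma^{-1}(i+1)$. **Theorem.** Let $n\ge 1$ and let $T$ be an unlabeled rooted binary tree with $n$ vertices in which no vertex has a left child but no right child. Let $\mathrm{And}^{I}(T)$,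 $\mathrm{And}^{II}(T)$ and $\mathrm{RS}(T)$ be the sets of André I, André II and simsun permutations of $[n]$ of shape $T$. Then $$\sum_{\sigma\in \mathrm{And}^{I}(T)} s^{\mathrm{ides}(\sigma)} \overset{(a)}{=} \sum_{\sigma\in \mathrm{And}^{II}(T)} s^{\mathrm{ides}(\sigma)} \overset{(b)}{=} \sum_{\sigma\in \mathrm{RS}(T)} s^{\mathrm{ides}(\sigma)}$$ as polynomials in $s$. -/

import Mathlib

open Polynomial

namespace AndreSimsun

/-- André I words (sequences of distinct letters): the empty word, the one-letter words, and the
words `τ m τ'` of length at least two in which `m` is the minimum letter, `τ` and `τ'` are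
André I, and the maximum letter of `τ τ'` lies in `τ'`. -/
inductive IsAndreI {α : Type*} [LinearOrder α] : List α → Prop
  | nil : IsAndreI []
  | single (a : α) : IsAndreI [a]
  | node (τ : List α) (m : α) (τ' : List α)
      (hlen : 2 ≤ (τ ++ m :: τ').length)
      (hm : ∀ x ∈ τ ++ τ', m < x)
      (hτ : IsAndreI τ) (hτ' : IsAndreI τ')
      (hmax : ∃ M ∈ τ', ∀ x ∈ τ ++ τ', x ≤ M) : IsAndreI (τ ++ m :: τ')

/-- André II words: as `IsAndreI`, but with the minimum letter of `τ τ'` lying in `τ'`. -/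
inductive IsAndreII {α : Type*} [LinearOrder α] : List α → Prop
  | nil : IsAndreII []
  | single (a : α) : IsAndreII [a]
  | node (τ : List α) (m : α) (τ' : List α)
      (hlen : 2 ≤ (τ ++ m :: τ').length)
      (hm : ∀ x ∈ τ ++ τ', m < x)
      (hτ : IsAndreII τ) (hτ' : IsAndreII τ')
      (hmin : ∃ M ∈ τ', ∀ x ∈ τ ++ τ', M ≤ x) : IsAndreII (τ ++ m :: τ')

/-- No three consecutive letters `a b c` of the word satisfy `a > b > c`. -/
def NoDoubleDescent {α : Type*} [LinearOrder α] (w : List α) : Prop :=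
  ∀ a b c : α, [a, b, c] <:+: w → ¬ (b < a ∧ c < b)

/-- Simsun words on the letters `1, …, n`: the last letter is `n`, and for every `k ≤ n` the word
that is left after removing the letters `n, n - 1, …, k + 1` has no double descent (`k = n` is
the word itself). -/
def IsSimsun (n : ℕ) (w : List ℕ) : Prop :=
  w.getLast? = some n ∧ ∀ k ≤ n, NoDoubleDescent (w.filter fun x => x ≤ k)

/-- The least letter of the nonempty word `a :: l`. -/
def least {α : Type*} [LinearOrder α] (a : α) (l : List α) : α := l.foldl min a

theorem least_mem {α : Type*} [LinearOrder α] (a : α) (l : List α) : least a l ∈ a :: l :=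
  List.min?_mem (xs := a :: l) (a := l.foldl min a) rfl

/-- The increasing binary tree of a word: its root is the least letter `m` of the word
`σ m τ`, and its left and right subtrees are the trees of `σ` and `τ`. -/
def incTree {α : Type*} [LinearOrder α] : List α → BinaryTree α
  | [] => .nil
  | a :: l =>
    .node (least a l)
      (incTree ((a :: l).take ((a :: l).idxOf (least a l))))
      (incTree ((a :: l).drop ((a :: l).idxOf (least a l) + 1)))
termination_by w => w.length
decreasing_by
  · have := List.idxOf_lt_length_of_mem (least_mem a l)
    simp only [List.length_take]
    omega
  · simp only [List.length_drop, List.length_cons]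
    omega

/-- The underlying unlabeled tree of a labeled binary tree. -/
def shape {α : Type*} (T : BinaryTree α) : BinaryTree Unit := T.map fun _ => ()

/-- No vertex of the tree has a left child but no right child. -/
def NoOnlyLeftChild : BinaryTree Unit → Prop
  | .nil => True
  | .node _ l r => (r = .nil → l = .nil) ∧ NoOnlyLeftChild l ∧ NoOnlyLeftChild r

/-- The unlabeled binary trees with `n` vertices in which no vertex has only a left child.
(The vertices of a `BinaryTree` are its `node`s; `nil` is the empty tree.) -/
def URL (n : ℕ) : Set (BinaryTree Unit) := {T | T.numNodes = n ∧ NoOnlyLeftChild T}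

/-- The word `σ₁ σ₂ ⋯ σₙ` on the letters `1, …, n` of a permutation. -/
def word {n : ℕ} (σ : Equiv.Perm (Fin n)) : List ℕ := List.ofFn fun i => (σ i : ℕ) + 1

/-- The number of descents, that is, of pairs of consecutive positions `i, i + 1`
with `σ i > σ (i + 1)`. -/
def des {n : ℕ} (σ : Equiv.Perm (Fin n)) : ℕ :=
  (Finset.univ.filter fun i : Fin n => ∃ h : (i : ℕ) + 1 < n, σ ⟨i + 1, h⟩ < σ i).card

/-- The number of inverse descents. -/
def ides {n : ℕ} (σ : Equiv.Perm (Fin n)) : ℕ := des σ⁻¹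

/-- The tree shape of a permutation. -/
def treeShape {n : ℕ} (σ : Equiv.Perm (Fin n)) : BinaryTree Unit := shape (incTree (word σ))

open scoped Classical in
/-- The André I permutations of `1, …, n` with tree shape `T`. -/
noncomputable def AndI (n : ℕ) (T : BinaryTree Unit) : Finset (Equiv.Perm (Fin n)) :=
  Finset.univ.filter fun σ => IsAndreI (word σ) ∧ treeShape σ = T

open scoped Classical in
/-- The André II permutations of `1, …, n` with tree shape `T`. -/
noncomputable def AndII (n : ℕ) (T : BinaryTree Unit) : Finset (Equiv.Perm (Fin n)) :=
  Finset.univ.filter fun σ => IsAndreII (word σ) ∧ treeShape σ = T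

open scoped Classical in
/-- The simsun permutations of `1, …, n` with tree shape `T`. -/
noncomputable def RS (n : ℕ) (T : BinaryTree Unit) : Finset (Equiv.Perm (Fin n)) :=
  Finset.univ.filter fun σ => IsSimsun n (word σ) ∧ treeShape σ = T

end AndreSimsun

/-! Allow repeated letters, with equal letters regarded as increasing from left to right. Each of
the three classes of shape `T` then extends to the words whose standardization lies in it. Words
over `N` letters with standardization `σ` become, after lowering their letters by the descents of
`σ⁻¹`, arbitrary weakly increasing words over `N - ides σ` letters (`card_sort_eq`). So a class has
`∑ M (N - ides σ)` words over `N` letters, where `M` is `monotoneCount`. As `M 0 = 0` and `M 1 = 1`,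
this system is triangular, and the counts for all `N` determine the distribution of `ides`
(`sum_X_pow_eq_of_sum_eq`). It remains to see that the three classes have equally many words over
every alphabet.

Split a word as `u m v` at its leftmost least letter, and count words on `[a, b]` that contain `b`
(André I, simsun) or `a` (André II). In the first case the maximum condition puts `b` in `v`, and
one sums over the root `m`. In the second the root is `a`, and one sums over the least letter `m` of
`v`. Either way `u` uses the letters of `(m, b]` and `v` those of `[m, b]`, including the relevant
extreme one, so both counts obey the recursion `extremeCount`. Summing over the extreme letter that
actually occurs gives all words (`wordCount`).

For simsun words, the left factor `u` is followed by the smaller letter `m`, and a word followed by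
a smaller letter has no double descents in all its restrictions exactly when it is André II
(`weakAndreII_iff_nestedNoDoubleDescent`). Hence simsun words have André II left factors along the
right branch, and the recursion sees only the number of these. -/

namespace AndreSimsun

/-! ### Decomposition of words at the least letter -/

section Trees

variable {α : Type*} [LinearOrder α]

/-- Every letter of `u` is at most some letter of `v`. -/
def MaxCond (u v : List α) : Prop := ∀ x ∈ u, ∃ M ∈ v, x ≤ M

/-- Every letter of `u` is larger than some letter of `v`. -/
def MinCond (u v : List α) : Prop := ∀ x ∈ u, ∃ M ∈ v, M < x

/-- The word splits as `u m v` at its leftmost least letter `m`, where `u` satisfies `P`,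
`v` satisfies `Q`, and `u`, `v` satisfy `C`. -/
def IsNode (C : List α → List α → Prop) (P Q : List α → Prop) (w : List α) : Prop :=
  ∃ u m v, w = u ++ m :: v ∧ (∀ x ∈ u, m < x) ∧ (∀ x ∈ v, m ≤ x) ∧ C u v ∧ P u ∧ Q v

/-- Words, possibly with repeated letters, whose standardization (equal letters increase from left
to right) is an André I word of shape `T`. -/
def WeakAndreI : BinaryTree Unit → List α → Prop
  | .nil => fun w => w = []
  | .node _ l r => IsNode MaxCond (WeakAndreI l) (WeakAndreI r)

/-- Words whose standardization is an André II word of shape `T`. -/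
def WeakAndreII : BinaryTree Unit → List α → Prop
  | .nil => fun w => w = []
  | .node _ l r => IsNode MinCond (WeakAndreII l) (WeakAndreII r)

/-- Words whose standardization is a simsun permutation of shape `T`. -/
def WeakSimsun : BinaryTree Unit → List α → Prop
  | .nil => fun w => w = []
  | .node _ l r => IsNode MaxCond (WeakAndreII l) (WeakSimsun r)

theorem split_at_least_unique {u u' v v' : List α} {m m' : α} (h : u ++ m :: v = u' ++ m' :: v')
    (hm : ∀ x ∈ u ++ v, m < x) (hm' : ∀ x ∈ u' ++ v', m' < x) : u = u' ∧ m = m' ∧ v = v' := by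
  have hmm : m = m' := by
    have h1 : m ∈ u' ++ m' :: v' := h ▸ by simp
    have h2 : m' ∈ u ++ m :: v := h ▸ by simp
    simp only [List.mem_append, List.mem_cons] at h1 h2 hm hm'
    have := hm m'
    have := hm' m
    grind
  subst hmm
  have hu : m ∉ u := fun hx => lt_irrefl _ (hm m (by simp [hx]))
  have hu' : m ∉ u' := fun hx => lt_irrefl _ (hm' m (by simp [hx]))
  have hlen : u.length = u'.length := by
    have h1 : (u ++ m :: v).idxOf m = u.length := by simp [List.idxOf_append_of_notMem hu]
    have h2 : (u' ++ m :: v').idxOf m = u'.length := by simp [List.idxOf_append_of_notMem hu']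
    rw [← h1, ← h2, h]
  obtain ⟨h1, h2⟩ := List.append_inj h hlen
  simp_all

theorem least_le (a : α) (l : List α) : ∀ x ∈ a :: l, least a l ≤ x := by
  intro x hx
  exact (List.min?_eq_some_iff.1 (show (a :: l).min? = some (least a l) from rfl)).2 x hx

theorem incTree_split {u v : List α} {m : α} (hm : ∀ x ∈ u ++ v, m < x) :
    incTree (u ++ m :: v) = .node m (incTree u) (incTree v) := by
  obtain ⟨a, l, hal⟩ : ∃ a l, u ++ m :: v = a :: l := by
    cases u <;> simp
  have hleast : least a l = m := by
    have h1 := least_mem a l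
    have h2 := least_le a l m (hal ▸ by simp)
    rw [← hal] at h1
    simp only [List.mem_append, List.mem_cons] at h1 hm
    have := hm (least a l)
    grind
  have hu : m ∉ u := fun hx => lt_irrefl _ (hm m (by simp [hx]))
  rw [hal, incTree, hleast, ← hal]
  simp [List.idxOf_append_of_notMem hu]

theorem exists_split_at_least {w : List α} (hw : w.Nodup) (h : w ≠ []) :
    ∃ u m v, w = u ++ m :: v ∧ ∀ x ∈ u ++ v, m < x := by
  obtain ⟨a, l, rfl⟩ := List.exists_cons_of_ne_nil h
  obtain ⟨u, v, huv⟩ := List.append_of_mem (least_mem a l)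
  refine ⟨u, least a l, v, huv, fun x hx => ?_⟩
  have hx' : x ∈ u ∨ x ∈ v := by simpa using hx
  refine lt_of_le_of_ne (least_le a l x (by rw [huv]; grind)) ?_
  rintro rfl
  rw [huv, List.nodup_append] at hw
  grind

theorem shape_incTree_eq_nil {w : List α} : shape (incTree w) = .nil ↔ w = [] := by
  cases w with
  | nil => simp [incTree, shape, BinaryTree.map]
  | cons a l => simp [incTree, shape, BinaryTree.map]

theorem shape_incTree_split {u v : List α} {m : α} (hm : ∀ x ∈ u ++ v, m < x)
    {l r : BinaryTree Unit} : shape (incTree (u ++ m :: v)) = .node () l r ↔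
      shape (incTree u) = l ∧ shape (incTree v) = r := by
  rw [incTree_split hm]
  simp [shape, BinaryTree.map]

/-- To identify `IsNode C P Q` with a property `R` of words together with a shape, it suffices to
describe `R` at the least letter. -/
theorem isNode_iff_of_split {C : List α → List α → Prop} {P Q R : List α → Prop}
    {l r : BinaryTree Unit} {w : List α} (hw : w.Nodup)
    (h : ∀ u m v, w = u ++ m :: v → (∀ x ∈ u ++ v, m < x) → u.Nodup → v.Nodup →
      (C u v ∧ P u ∧ Q v ↔ R w ∧ shape (incTree u) = l ∧ shape (incTree v) = r)) :
    IsNode C P Q w ↔ R w ∧ shape (incTree w) = .node () l r := by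
  constructor
  · rintro ⟨u, m, v, rfl, hu, hv, hCPQ⟩
    have hnd := List.nodup_append.1 hw
    have hm : ∀ x ∈ u ++ v, m < x := by
      intro x hx
      rcases List.mem_append.1 hx with hx | hx
      · exact hu x hx
      · refine lt_of_le_of_ne (hv x hx) ?_
        rintro rfl
        exact (List.nodup_cons.1 hnd.2.1).1 hx
    rw [shape_incTree_split hm]
    exact (h u m v rfl hm hnd.1 (List.nodup_cons.1 hnd.2.1).2).1 hCPQ
  · rintro ⟨hR, hs⟩
    have hne : w ≠ [] := by
      rintro rfl
      simp [incTree, shape, BinaryTree.map] at hs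
    obtain ⟨u, m, v, rfl, hm⟩ := exists_split_at_least hw hne
    have hnd := List.nodup_append.1 hw
    rw [shape_incTree_split hm] at hs
    refine ⟨u, m, v, rfl, fun x hx => hm x (by simp [hx]), fun x hx => (hm x (by simp [hx])).le, ?_⟩
    exact (h u m v rfl hm hnd.1 (List.nodup_cons.1 hnd.2.1).2).2 ⟨hR, hs⟩

theorem exists_max_mem {v : List α} (h : v ≠ []) : ∃ M ∈ v, ∀ x ∈ v, x ≤ M := by
  obtain ⟨M, hM, hle⟩ := v.toFinset.exists_max_image id (by simpa [Finset.nonempty_iff_ne_empty])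
  exact ⟨M, by simpa using hM, fun x hx => hle x (by simpa using hx)⟩

theorem exists_min_mem {v : List α} (h : v ≠ []) : ∃ M ∈ v, ∀ x ∈ v, M ≤ x := by
  obtain ⟨M, hM, hle⟩ := v.toFinset.exists_min_image id (by simpa [Finset.nonempty_iff_ne_empty])
  exact ⟨M, by simpa using hM, fun x hx => hle x (by simpa using hx)⟩

/-- `MaxCond u []` forces `u = []`, so the one-letter words need no separate case. -/
theorem isAndreI_split {u v : List α} {m : α} (hm : ∀ x ∈ u ++ v, m < x) :
    IsAndreI (u ++ m :: v) ↔ MaxCond u v ∧ IsAndreI u ∧ IsAndreI v := by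
  constructor
  · intro h
    generalize hw : u ++ m :: v = w at h
    cases h with
    | nil => simp at hw
    | single a =>
      obtain ⟨rfl, rfl, rfl⟩ : u = [] ∧ m = a ∧ v = [] := by
        cases u <;> simp_all
      exact ⟨by simp [MaxCond], .nil, .nil⟩
    | node τ k τ' hlen hk hτ hτ' hmax =>
      obtain ⟨rfl, rfl, rfl⟩ := split_at_least_unique hw hm hk
      obtain ⟨M, hM, hle⟩ := hmax
      exact ⟨fun x hx => ⟨M, hM, hle x (by simp [hx])⟩, hτ, hτ'⟩
  · rintro ⟨hC, hu, hv⟩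
    rcases eq_or_ne v [] with rfl | hne
    · obtain rfl : u = [] := List.eq_nil_iff_forall_not_mem.2 fun x hx => by
        simpa using hC x hx
      exact .single m
    · obtain ⟨M, hM, hle⟩ := exists_max_mem hne
      have := List.length_pos_iff.2 hne
      refine .node u m v (by simp; omega) hm hu hv ⟨M, hM, fun x hx => ?_⟩
      rcases List.mem_append.1 hx with hx | hx
      · obtain ⟨y, hy, hxy⟩ := hC x hx
        exact hxy.trans (hle y hy)
      · exact hle x hx

/-- Disjointness of `u` and `v` turns the weak inequality of the definition into the strict one of
`MinCond`, which is the right form when ties are broken from left to right. -/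
theorem isAndreII_split {u v : List α} {m : α} (hm : ∀ x ∈ u ++ v, m < x)
    (huv : ∀ x ∈ u, x ∉ v) :
    IsAndreII (u ++ m :: v) ↔ MinCond u v ∧ IsAndreII u ∧ IsAndreII v := by
  constructor
  · intro h
    generalize hw : u ++ m :: v = w at h
    cases h with
    | nil => simp at hw
    | single a =>
      obtain ⟨rfl, rfl, rfl⟩ : u = [] ∧ m = a ∧ v = [] := by
        cases u <;> simp_all
      exact ⟨by simp [MinCond], .nil, .nil⟩
    | node τ k τ' hlen hk hτ hτ' hmin =>
      obtain ⟨rfl, rfl, rfl⟩ := split_at_least_unique hw hm hk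
      obtain ⟨M, hM, hle⟩ := hmin
      refine ⟨fun x hx => ⟨M, hM, lt_of_le_of_ne (hle x (by simp [hx])) ?_⟩, hτ, hτ'⟩
      rintro rfl
      exact huv _ hx hM
  · rintro ⟨hC, hu, hv⟩
    rcases eq_or_ne v [] with rfl | hne
    · obtain rfl : u = [] := List.eq_nil_iff_forall_not_mem.2 fun x hx => by
        simpa using hC x hx
      exact .single m
    · obtain ⟨M, hM, hle⟩ := exists_min_mem hne
      have := List.length_pos_iff.2 hne
      refine .node u m v (by simp; omega) hm hu hv ⟨M, hM, fun x hx => ?_⟩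
      rcases List.mem_append.1 hx with hx | hx
      · obtain ⟨y, hy, hxy⟩ := hC x hx
        exact (hle y hy).trans hxy.le
      · exact hle x hx

theorem weakAndreI_iff {T : BinaryTree Unit} {w : List α} (hw : w.Nodup) :
    WeakAndreI T w ↔ IsAndreI w ∧ shape (incTree w) = T := by
  induction T generalizing w with
  | nil =>
    rw [shape_incTree_eq_nil]
    exact ⟨by rintro rfl; exact ⟨.nil, rfl⟩, And.right⟩
  | node _ l r ihl ihr =>
    refine isNode_iff_of_split hw ?_
    rintro u m v rfl hm hu hv
    rw [ihl hu, ihr hv, isAndreI_split hm]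
    tauto

theorem weakAndreII_iff {T : BinaryTree Unit} {w : List α} (hw : w.Nodup) :
    WeakAndreII T w ↔ IsAndreII w ∧ shape (incTree w) = T := by
  induction T generalizing w with
  | nil =>
    rw [shape_incTree_eq_nil]
    exact ⟨by rintro rfl; exact ⟨.nil, rfl⟩, And.right⟩
  | node _ l r ihl ihr =>
    refine isNode_iff_of_split hw ?_
    rintro u m v rfl hm hu hv
    rw [ihl hu, ihr hv, isAndreII_split hm]
    · tauto
    · intro x hx hx'
      exact (List.nodup_append.1 hw).2.2 x hx x (by simp [hx']) rfl

/-! ### Double descents and the simsun condition -/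

theorem noDoubleDescent_of_length_le {w : List α} (h : w.length ≤ 2) : NoDoubleDescent w := by
  intro a b c habc
  have := habc.length_le
  simp at this
  omega

theorem noDoubleDescent_cons {a b c : α} {l : List α} :
    NoDoubleDescent (a :: b :: c :: l) ↔ ¬ (b < a ∧ c < b) ∧ NoDoubleDescent (b :: c :: l) := by
  constructor
  · intro h
    refine ⟨h a b c ⟨[], l, by simp⟩, fun x y z hxyz => h x y z ?_⟩
    exact hxyz.trans (List.suffix_cons _ _).isInfix
  · rintro ⟨h1, h2⟩ x y z hxyz
    rcases List.infix_cons_iff.1 hxyz with h | h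
    · simp only [List.cons_prefix_cons] at h
      obtain ⟨rfl, rfl, rfl, -⟩ := h
      exact h1
    · exact h2 x y z h

/-- A double descent cannot involve letters on both sides of a letter followed by a larger one. -/
theorem noDoubleDescent_split {u v : List α} {m : α} (hv : ∀ x ∈ v.head?, m < x) :
    NoDoubleDescent (u ++ m :: v) ↔ NoDoubleDescent (u ++ [m]) ∧ NoDoubleDescent v := by
  induction u with
  | nil =>
    have h1 : NoDoubleDescent [m] := noDoubleDescent_of_length_le (by simp)
    match v with
    | [] => simp [h1, noDoubleDescent_of_length_le]
    | [a] => simp [h1, noDoubleDescent_of_length_le]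
    | a :: b :: l =>
      have := hv a (by simp)
      simp [noDoubleDescent_cons, h1, not_lt_of_gt this]
  | cons a u ih =>
    match u with
    | [] =>
      have h1 : NoDoubleDescent [m] := noDoubleDescent_of_length_le (by simp)
      have h2 : NoDoubleDescent [a, m] := noDoubleDescent_of_length_le (by simp)
      match v with
      | [] => simp [noDoubleDescent_of_length_le]
      | b :: l =>
        have := hv b (by simp)
        simp only [List.nil_append] at ih
        simp [noDoubleDescent_cons, h2, not_lt_of_gt this, ih, h1]
    | [b] =>
      simp only [List.cons_append, List.nil_append] at ih
      simp only [List.cons_append, List.nil_append, noDoubleDescent_cons, ih]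
      tauto
    | b :: c :: u =>
      simp only [List.cons_append] at ih
      simp only [List.cons_append, noDoubleDescent_cons, ih]
      tauto

/-- A double descent at the least letter `m` can only be caused by a smaller final letter. -/
theorem noDoubleDescent_split_append {u v : List α} {m k : α} (hkm : k < m) (hu : ∀ x ∈ u, m < x)
    (hv : ∀ x ∈ v, m < x) : NoDoubleDescent (u ++ m :: v ++ [k]) ↔
      (u ≠ [] → v ≠ []) ∧ NoDoubleDescent (u ++ [m]) ∧ NoDoubleDescent (v ++ [k]) := by
  rcases eq_or_ne v [] with rfl | hne
  · rcases u.eq_nil_or_concat with rfl | ⟨u, a, rfl⟩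
    · simp [noDoubleDescent_of_length_le]
    · have := hu a (by simp)
      simp only [ne_eq, not_true_eq_false, imp_false, not_not]
      constructor
      · intro h
        -- With nothing between `m` and `k`, the last letter of `u` completes the double descent `a
        -- > m > k`.
        exact absurd ⟨this, hkm⟩ (h a m k ⟨u, [], by simp⟩)
      · rintro ⟨h, -⟩
        simp at h
  · obtain ⟨b, v, rfl⟩ := List.exists_cons_of_ne_nil hne
    have hb := hv b (by simp)
    rw [List.append_assoc, List.cons_append, noDoubleDescent_split (by simpa using hb)]
    simp

end Trees

/-- Every restriction of `w` to its small letters has no double descent, even if followed by `k`. -/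
def NestedNoDoubleDescent (w s : List ℕ) : Prop :=
  ∀ k, NoDoubleDescent (w.filter (fun x => x ≤ k) ++ s)

theorem filter_eq_nil_of_lt {w : List ℕ} {k m : ℕ} (hw : ∀ x ∈ w, m < x) (h : k < m) :
    w.filter (fun x => x ≤ k) = [] := by
  rw [List.filter_eq_nil_iff]
  intro x hx
  have := hw x hx
  simp
  omega

/-- A cutoff below `m` leaves nothing. Any other cutoff keeps `m`, which is then last or followed by
a larger letter, so double descents on its two sides do not interact. -/
theorem nestedNoDoubleDescent_split {u v : List ℕ} {m : ℕ} (hu : ∀ x ∈ u, m < x)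
    (hv : ∀ x ∈ v, m < x) : NestedNoDoubleDescent (u ++ m :: v) [] ↔
      NestedNoDoubleDescent u [m] ∧ NestedNoDoubleDescent v [] := by
  unfold NestedNoDoubleDescent
  rw [← forall_and]
  refine forall_congr' fun k => ?_
  rcases le_or_gt m k with hmk | hmk
  · rw [List.filter_append, List.filter_cons_of_pos (by simpa using hmk), List.append_nil,
      noDoubleDescent_split, List.append_nil]
    intro x hx
    exact hv x (List.mem_of_mem_filter (List.mem_of_mem_head? hx))
  · simp [filter_eq_nil_of_lt hu hmk, filter_eq_nil_of_lt hv hmk, hmk,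
      noDoubleDescent_of_length_le]

/-- The minimum condition arises here: `m` ends up in the middle of a double descent exactly when
some cutoff keeps a letter of `u` but none of `v`. -/
theorem nestedNoDoubleDescent_split_append {u v : List ℕ} {m j : ℕ} (hj : j < m)
    (hu : ∀ x ∈ u, m < x) (hv : ∀ x ∈ v, m < x) (huv : ∀ x ∈ u, x ∉ v) :
    NestedNoDoubleDescent (u ++ m :: v) [j] ↔
      MinCond u v ∧ NestedNoDoubleDescent u [m] ∧ NestedNoDoubleDescent v [j] := by
  have hC : MinCond u v ↔
      ∀ k, u.filter (fun x => x ≤ k) ≠ [] → v.filter (fun x => x ≤ k) ≠ [] := by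
    simp only [ne_eq, List.filter_eq_nil_iff, decide_eq_true_eq, not_forall, not_not]
    constructor
    · rintro h k ⟨x, hx, hxk⟩
      obtain ⟨y, hy, hyx⟩ := h x hx
      exact ⟨y, hy, by omega⟩
    · intro h x hx
      obtain ⟨y, hy, hyx⟩ := h x ⟨x, hx, le_rfl⟩
      refine ⟨y, hy, lt_of_le_of_ne hyx ?_⟩
      rintro rfl
      exact huv _ hx hy
  rw [hC]
  unfold NestedNoDoubleDescent
  rw [← forall_and, ← forall_and]
  refine forall_congr' fun k => ?_
  rcases le_or_gt m k with hmk | hmk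
  · rw [List.filter_append, List.filter_cons_of_pos (by simpa using hmk),
      noDoubleDescent_split_append hj]
    · exact fun x hx => hu x (List.mem_of_mem_filter hx)
    · exact fun x hx => hv x (List.mem_of_mem_filter hx)
  · simp [filter_eq_nil_of_lt hu hmk, filter_eq_nil_of_lt hv hmk, hmk,
      noDoubleDescent_of_length_le]

/-- The bridge between André II and simsun words. The final letter `j` varies in the induction,
because `u` is followed by `m` whereas `v` is still followed by `j`. -/
theorem weakAndreII_iff_nestedNoDoubleDescent {T : BinaryTree Unit} {w : List ℕ} (hw : w.Nodup)
    {j : ℕ} (hj : ∀ x ∈ w, j < x) :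
    WeakAndreII T w ↔ NestedNoDoubleDescent w [j] ∧ shape (incTree w) = T := by
  induction T generalizing w j with
  | nil =>
    rw [shape_incTree_eq_nil]
    refine ⟨?_, And.right⟩
    rintro rfl
    exact ⟨fun k => noDoubleDescent_of_length_le (by simp), rfl⟩
  | node _ l r ihl ihr =>
    refine isNode_iff_of_split (R := fun w => NestedNoDoubleDescent w [j]) hw ?_
    rintro u m v rfl hm hu hv
    have hm1 : ∀ x ∈ u, m < x := fun x hx => hm x (by simp [hx])
    have hm2 : ∀ x ∈ v, m < x := fun x hx => hm x (by simp [hx])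
    rw [ihl hu hm1, ihr hv fun x hx => hj x (by simp [hx]),
      nestedNoDoubleDescent_split_append (hj m (by simp)) hm1 hm2]
    · tauto
    · intro x hx hx'
      exact (List.nodup_append.1 hw).2.2 x hx x (by simp [hx']) rfl

/-- The last letter, if there is one, is the largest. -/
def LastIsMax (w : List ℕ) : Prop := ∀ M ∈ w.getLast?, ∀ x ∈ w, x ≤ M

theorem lastIsMax_split {u v : List ℕ} {m : ℕ} (hm : ∀ x ∈ u ++ v, m < x) :
    LastIsMax (u ++ m :: v) ↔ MaxCond u v ∧ LastIsMax v := by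
  rcases v.eq_nil_or_concat with rfl | ⟨v, a, rfl⟩
  · simp only [LastIsMax, MaxCond, List.getLast?_append, List.getLast?_singleton]
    simp
    constructor
    · intro h x hx
      have := h x (Or.inl hx)
      have := hm x (by simp [hx])
      omega
    · rintro h x (hx | rfl)
      · exact absurd hx (h x)
      · exact le_rfl
  · have h1 : (u ++ m :: (v.concat a)).getLast? = some a := by
      rw [List.concat_eq_append, ← List.cons_append, ← List.append_assoc, List.getLast?_concat]
    have hma := hm a (by simp)
    simp only [LastIsMax, MaxCond, h1]
    simp only [List.concat_eq_append, List.getLast?_append, List.getLast?_singleton,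
      Option.some_or, Option.mem_some_iff, forall_eq', List.mem_append, List.mem_cons,
      List.not_mem_nil, or_false]
    constructor
    · intro h
      exact ⟨fun x hx => ⟨a, by simp, h x (by simp [hx])⟩, fun x hx => h x (by tauto)⟩
    · rintro ⟨h, h2⟩ x (hx | rfl | hx)
      · obtain ⟨y, hy, hxy⟩ := h x hx
        exact hxy.trans (h2 y hy)
      · exact hma.le
      · exact h2 x hx

/-- The left factor is followed by the smaller root and so is André II; the right factor ends the
word and so is again simsun. -/
theorem weakSimsun_iff {T : BinaryTree Unit} {w : List ℕ} (hw : w.Nodup) :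
    WeakSimsun T w ↔ (LastIsMax w ∧ NestedNoDoubleDescent w []) ∧ shape (incTree w) = T := by
  induction T generalizing w with
  | nil =>
    rw [shape_incTree_eq_nil]
    refine ⟨?_, And.right⟩
    rintro rfl
    exact ⟨⟨by simp [LastIsMax], fun k => noDoubleDescent_of_length_le (by simp)⟩, rfl⟩
  | node _ l r ihl ihr =>
    refine isNode_iff_of_split (R := fun w => LastIsMax w ∧ NestedNoDoubleDescent w []) hw ?_
    rintro u m v rfl hm hu hv
    have hm1 : ∀ x ∈ u, m < x := fun x hx => hm x (by simp [hx])
    have hm2 : ∀ x ∈ v, m < x := fun x hx => hm x (by simp [hx])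
    rw [weakAndreII_iff_nestedNoDoubleDescent hu hm1, ihr hv, lastIsMax_split hm,
      nestedNoDoubleDescent_split hm1 hm2]
    tauto

/-! ### Invariance under standardization -/

section Transfer

variable {ι α β : Type*} [LinearOrder α] [LinearOrder β]

/-- If `f` and `g` order the letters of `l` in the same way (with equal letters increasing from left
to right), then a decomposition of `l.map f` at its least letter induces one of `l.map g`. -/
theorem IsNode.of_map {C : List α → List α → Prop} {C' : List β → List β → Prop}
    {P Q : List α → Prop} {P' Q' : List β → Prop} {f : ι → α} {g : ι → β} {l : List ι}
    (hl : l.Pairwise fun i j => f i ≤ f j ↔ g i ≤ g j)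
    (hC : ∀ u v : List ι, (∀ i ∈ u, ∀ j ∈ v, f i ≤ f j ↔ g i ≤ g j) →
      C (u.map f) (v.map f) → C' (u.map g) (v.map g))
    (hP : ∀ u : List ι, (u.Pairwise fun i j => f i ≤ f j ↔ g i ≤ g j) → P (u.map f) → P' (u.map g))
    (hQ : ∀ u : List ι, (u.Pairwise fun i j => f i ≤ f j ↔ g i ≤ g j) → Q (u.map f) → Q' (u.map g))
    (h : IsNode C P Q (l.map f)) : IsNode C' P' Q' (l.map g) := by
  obtain ⟨u, m, v, hw, hu, hv, h1, h2, h3⟩ := h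
  obtain ⟨u, l', rfl, rfl, hl'⟩ := List.map_eq_append_iff.1 hw
  obtain ⟨m, v, rfl, rfl, rfl⟩ := List.map_eq_cons_iff.1 hl'
  obtain ⟨hl1, hl2, hl3⟩ := List.pairwise_append.1 hl
  obtain ⟨hl4, hl5⟩ := List.pairwise_cons.1 hl2
  refine ⟨u.map g, g m, v.map g, by simp, ?_, ?_, 
    hC u v (fun i hi j hj => hl3 i hi j (by simp [hj])) h1, hP u hl1 h2, hQ v hl5 h3⟩
  · simp only [List.mem_map, forall_exists_index, and_imp, forall_apply_eq_imp_iff₂] at hu ⊢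
    intro i hi
    rw [← not_le, ← hl3 i hi m (by simp), not_le]
    exact hu i hi
  · simp only [List.mem_map, forall_exists_index, and_imp, forall_apply_eq_imp_iff₂] at hv ⊢
    intro i hi
    exact (hl4 i hi).1 (hv i hi)

theorem MaxCond.of_map {f : ι → α} {g : ι → β} {u v : List ι}
    (h : ∀ i ∈ u, ∀ j ∈ v, f i ≤ f j ↔ g i ≤ g j) (hC : MaxCond (u.map f) (v.map f)) :
    MaxCond (u.map g) (v.map g) := by
  simp only [MaxCond, List.mem_map, forall_exists_index, and_imp, forall_apply_eq_imp_iff₂,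
    exists_exists_and_eq_and] at hC ⊢
  intro i hi
  obtain ⟨j, hj, hij⟩ := hC i hi
  exact ⟨j, hj, (h i hi j hj).1 hij⟩

theorem MinCond.of_map {f : ι → α} {g : ι → β} {u v : List ι}
    (h : ∀ i ∈ u, ∀ j ∈ v, f i ≤ f j ↔ g i ≤ g j) (hC : MinCond (u.map f) (v.map f)) :
    MinCond (u.map g) (v.map g) := by
  simp only [MinCond, List.mem_map, forall_exists_index, and_imp, forall_apply_eq_imp_iff₂,
    exists_exists_and_eq_and] at hC ⊢
  intro i hi
  obtain ⟨j, hj, hij⟩ := hC i hi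
  exact ⟨j, hj, by rw [← not_le, ← h i hi j hj, not_le]; exact hij⟩

theorem WeakAndreI.of_map {T : BinaryTree Unit} {f : ι → α} {g : ι → β} {l : List ι}
    (hl : l.Pairwise fun i j => f i ≤ f j ↔ g i ≤ g j) (h : WeakAndreI T (l.map f)) :
    WeakAndreI T (l.map g) := by
  induction T generalizing l with
  | nil => simpa [WeakAndreI] using h
  | node _ a b iha ihb =>
    exact IsNode.of_map hl (fun _ _ => MaxCond.of_map) (fun _ => iha) (fun _ => ihb) h

theorem WeakAndreII.of_map {T : BinaryTree Unit} {f : ι → α} {g : ι → β} {l : List ι}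
    (hl : l.Pairwise fun i j => f i ≤ f j ↔ g i ≤ g j) (h : WeakAndreII T (l.map f)) :
    WeakAndreII T (l.map g) := by
  induction T generalizing l with
  | nil => simpa [WeakAndreII] using h
  | node _ a b iha ihb =>
    exact IsNode.of_map hl (fun _ _ => MinCond.of_map) (fun _ => iha) (fun _ => ihb) h

theorem WeakSimsun.of_map {T : BinaryTree Unit} {f : ι → α} {g : ι → β} {l : List ι}
    (hl : l.Pairwise fun i j => f i ≤ f j ↔ g i ≤ g j) (h : WeakSimsun T (l.map f)) :
    WeakSimsun T (l.map g) := by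
  induction T generalizing l with
  | nil => simpa [WeakSimsun] using h
  | node _ a b _ ihb =>
    exact IsNode.of_map hl (fun _ _ => MaxCond.of_map) (fun _ => WeakAndreII.of_map)
      (fun _ => ihb) h

end Transfer

/-! ### Counting words of a given shape over an interval -/

section Counting

/-- The words with property `W` and letters in `[a, b)`. -/
def wordsIn (W : List ℕ → Prop) (a b : ℕ) : Set (List ℕ) := {w | W w ∧ ∀ x ∈ w, a ≤ x ∧ x < b}

/-- The words with property `W` and letters in `[a, b]` that contain the letter `k`. -/
def wordsWith (W : List ℕ → Prop) (a b k : ℕ) : Set (List ℕ) :=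
  {w | W w ∧ (∀ x ∈ w, a ≤ x ∧ x ≤ b) ∧ k ∈ w}

/-- The number of words of shape `T` on `d + 1` consecutive letters that contain the extreme
letter which determines the end of the rightmost branch. -/
def extremeCount : BinaryTree Unit → ℕ → ℕ
  | .nil, _ => 0
  | .node _ l r, d => if r = .nil then 1 else
      ∑ e ∈ Finset.range (d + 1),
        (if l = .nil then 1 else ∑ i ∈ Finset.range e, extremeCount l i) * extremeCount r e

/-- The number of words of shape `T` on `N` consecutive letters. -/
def wordCount (T : BinaryTree Unit) (N : ℕ) : ℕ :=
  if T = .nil then 1 else ∑ i ∈ Finset.range N, extremeCount T i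

theorem finite_length_bounded (n b : ℕ) : {w : List ℕ | w.length = n ∧ ∀ x ∈ w, x < b}.Finite := by
  refine ((List.finite_length_eq (Fin b) n).image (List.map Fin.val)).subset ?_
  rintro w ⟨hw, hb⟩
  refine ⟨w.pmap (fun x h => ⟨x, h⟩) hb, by simpa using hw, ?_⟩
  simp [List.map_pmap]

theorem finite_wordsIn {W : List ℕ → Prop} {n : ℕ} (hW : ∀ w, W w → w.length = n) (a b : ℕ) :
    (wordsIn W a b).Finite :=
  (finite_length_bounded n b).subset fun w hw => ⟨hW w hw.1, fun x hx => (hw.2 x hx).2⟩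

theorem finite_wordsWith {W : List ℕ → Prop} {n : ℕ} (hW : ∀ w, W w → w.length = n) (a b k : ℕ) :
    (wordsWith W a b k).Finite :=
  (finite_length_bounded n (b + 1)).subset fun w hw =>
    ⟨hW w hw.1, fun x hx => Nat.lt_succ_of_le (hw.2.1 x hx).2⟩

theorem ncard_biUnion {β : Type*} (s : Finset ℕ) (B : ℕ → Set β) (hB : ∀ m, (B m).Finite)
    (hd : ∀ m ∈ s, ∀ m' ∈ s, ∀ v ∈ B m, v ∈ B m' → m = m') :
    {w | ∃ m ∈ s, w ∈ B m}.ncard = ∑ m ∈ s, (B m).ncard := by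
  classical
  have h : {w | ∃ m ∈ s, w ∈ B m} = ((s.biUnion fun m => (hB m).toFinset : Finset β) : Set β) := by
    ext w
    simp
  rw [h, Set.ncard_coe_finset, Finset.card_biUnion]
  · exact Finset.sum_congr rfl fun m _ => (Set.ncard_eq_toFinset_card _ (hB m)).symm
  · intro m hm m' hm' hne
    rw [Function.onFun, Finset.disjoint_left]
    intro v hv hv'
    exact hne (hd m hm m' hm' v (by simpa using hv) (by simpa using hv'))

/-- The fixed length of `u` makes the cut recoverable. The root letter `p m` is separate from the
index `m`: when `p` is constant, `m` has to be recovered from `v`. -/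
theorem ncard_concat (s : Finset ℕ) (p : ℕ → ℕ) (A B : ℕ → Set (List ℕ)) (n : ℕ)
    (hA : ∀ m, (A m).Finite) (hB : ∀ m, (B m).Finite) (hn : ∀ m, ∀ u ∈ A m, u.length = n)
    (hinj : ∀ m ∈ s, ∀ m' ∈ s, p m = p m' → ∀ v ∈ B m, v ∈ B m' → m = m') :
    {w | ∃ m ∈ s, ∃ u ∈ A m, ∃ v ∈ B m, w = u ++ p m :: v}.ncard =
      ∑ m ∈ s, (A m).ncard * (B m).ncard := by
  have h : {w | ∃ m ∈ s, ∃ u ∈ A m, ∃ v ∈ B m, w = u ++ p m :: v} =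
      {w | ∃ m ∈ s, w ∈ (fun q : List ℕ × List ℕ => q.1 ++ p m :: q.2) '' (A m ×ˢ B m)} := by
    ext w
    simp only [Set.mem_ofPred_eq, Set.mem_image, Set.mem_prod, Prod.exists]
    grind
  rw [h, ncard_biUnion]
  · refine Finset.sum_congr rfl fun m _ => ?_
    rw [Set.InjOn.ncard_image, Set.ncard_prod]
    rintro ⟨u, v⟩ ⟨hu, -⟩ ⟨u', v'⟩ ⟨hu', -⟩ h
    obtain ⟨h1, h2⟩ := List.append_inj h ((hn m u hu).trans (hn m u' hu').symm)
    simp_all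
  · exact fun m => ((hA m).prod (hB m)).image _
  · rintro m hm m' hm' _ ⟨⟨u, v⟩, ⟨hu, hv⟩, rfl⟩ ⟨⟨u', v'⟩, ⟨hu', hv'⟩, h⟩
    obtain ⟨h1, h2⟩ := List.append_inj h ((hn m' u' hu').trans (hn m u hu).symm)
    simp only [List.cons.injEq] at h2
    obtain ⟨h2, h3⟩ := h2
    simp only at h3 hv'
    subst h3
    exact hinj m hm m' hm' h2.symm _ hv hv'

theorem sum_Icc_sub (f : ℕ → ℕ) {a b : ℕ} (h : a ≤ b) :
    ∑ m ∈ Finset.Icc a b, f (b - m) = ∑ e ∈ Finset.range (b - a + 1), f e := by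
  refine Finset.sum_nbij' (fun m => b - m) (fun e => b - e) ?_ ?_ ?_ ?_ fun _ _ => rfl <;>
    simp only [Finset.mem_Icc, Finset.mem_range] <;> intros <;> omega

theorem sum_Ico_sub_left (f : ℕ → ℕ) (a b : ℕ) :
    ∑ m ∈ Finset.Ico a b, f (m - a) = ∑ e ∈ Finset.range (b - a), f e := by
  refine Finset.sum_nbij' (fun m => m - a) (fun e => a + e) ?_ ?_ ?_ ?_ fun _ _ => rfl <;>
    simp only [Finset.mem_Ico, Finset.mem_range] <;> intros <;> omega

theorem sum_Ico_sub_right (f : ℕ → ℕ) (a b : ℕ) :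
    ∑ m ∈ Finset.Ico a b, f (b - 1 - m) = ∑ e ∈ Finset.range (b - a), f e := by
  refine Finset.sum_nbij' (fun m => b - 1 - m) (fun e => b - 1 - e) ?_ ?_ ?_ ?_ fun _ _ => rfl <;>
    simp only [Finset.mem_Ico, Finset.mem_range] <;> intros <;> omega

/-- Words are classified by their largest letter. -/
theorem ncard_wordsIn_of_max {W : List ℕ → Prop} {n : ℕ} (hW : ∀ w, W w → w.length = n)
    (hne : ¬ W []) {f : ℕ → ℕ} (hf : ∀ a b, a ≤ b → (wordsWith W a b b).ncard = f (b - a))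
    (a b : ℕ) : (wordsIn W a b).ncard = ∑ i ∈ Finset.range (b - a), f i := by
  have h : wordsIn W a b = {w | ∃ m ∈ Finset.Ico a b, w ∈ wordsWith W a m m} := by
    ext w
    constructor
    · rintro ⟨hw, hx⟩
      obtain ⟨M, hM, hle⟩ := exists_max_mem (v := w) (by rintro rfl; exact hne hw)
      exact ⟨M, by simpa using hx M hM, hw, fun x hx' => ⟨(hx x hx').1, hle x hx'⟩, hM⟩
    · rintro ⟨m, hm, hw, hx, -⟩
      refine ⟨hw, fun x hx' => ⟨(hx x hx').1, (hx x hx').2.trans_lt (Finset.mem_Ico.1 hm).2⟩⟩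
  rw [h, ncard_biUnion _ _ (fun m => finite_wordsWith hW a m m), ← sum_Ico_sub_left]
  · exact Finset.sum_congr rfl fun m hm => hf a m (Finset.mem_Ico.1 hm).1
  · rintro m - m' - w ⟨-, h1, h2⟩ ⟨-, h3, h4⟩
    exact le_antisymm (h3 m h2).2 (h1 m' h4).2

theorem ncard_wordsIn_of_min {W : List ℕ → Prop} {n : ℕ} (hW : ∀ w, W w → w.length = n)
    (hne : ¬ W []) {f : ℕ → ℕ} (hf : ∀ a b, a ≤ b → (wordsWith W a b a).ncard = f (b - a))
    (a b : ℕ) : (wordsIn W a b).ncard = ∑ i ∈ Finset.range (b - a), f i := by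
  have h : wordsIn W a b = {w | ∃ m ∈ Finset.Ico a b, w ∈ wordsWith W m (b - 1) m} := by
    ext w
    constructor
    · rintro ⟨hw, hx⟩
      obtain ⟨M, hM, hle⟩ := exists_min_mem (v := w) (by rintro rfl; exact hne hw)
      exact ⟨M, by simpa using hx M hM, hw,
        fun x hx' => ⟨hle x hx', Nat.le_sub_one_of_lt (hx x hx').2⟩, hM⟩
    · rintro ⟨m, hm, hw, hx, -⟩
      have := Finset.mem_Ico.1 hm
      refine ⟨hw, fun x hx' => ?_⟩
      have := hx x hx'
      omega
  rw [h, ncard_biUnion _ _ (fun m => finite_wordsWith hW m (b - 1) m), ← sum_Ico_sub_right]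
  · exact Finset.sum_congr rfl fun m hm => hf m (b - 1) (by have := Finset.mem_Ico.1 hm; omega)
  · rintro m - m' - w ⟨-, h1, h2⟩ ⟨-, h3, h4⟩
    exact le_antisymm (h1 m' h4).1 (h3 m h2).1

theorem wordsWith_isNode_max {P Q : List ℕ → Prop} (hQ : ¬ Q []) (a b : ℕ) :
    wordsWith (IsNode MaxCond P Q) a b b = {w | ∃ m ∈ Finset.Icc a b,
      ∃ u ∈ wordsIn P (m + 1) (b + 1), ∃ v ∈ wordsWith Q m b b, w = u ++ m :: v} := by
  ext w
  constructor
  · rintro ⟨⟨u, m, v, rfl, hu, hv, hC, hPu, hQv⟩, hx, hb⟩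
    have hvb : ∀ x ∈ v, x ≤ b := fun x h => (hx x (by simp [h])).2
    refine ⟨m, by simpa using hx m (by simp), u, ⟨hPu, fun x h => ⟨hu x h, ?_⟩⟩, v,
      ⟨hQv, fun x h => ⟨hv x h, hvb x h⟩, ?_⟩, rfl⟩
    · exact Nat.lt_succ_of_le (hx x (by simp [h])).2
    · rcases List.mem_append.1 hb with h | h
      · obtain ⟨M, hM, hle⟩ := hC b h
        exact le_antisymm hle (hvb M hM) ▸ hM
      · rcases List.mem_cons.1 h with rfl | h
        -- If the root is `b` itself, the nonempty `v` has all its letters in `[b, b]`.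
        · obtain ⟨y, v, rfl⟩ := List.exists_cons_of_ne_nil (by rintro rfl; exact hQ hQv : v ≠ [])
          have := le_antisymm (hvb y (by simp)) (hv y (by simp))
          simp [this]
        · exact h
  · rintro ⟨m, hm, u, ⟨hPu, hu⟩, v, ⟨hQv, hv, hb⟩, rfl⟩
    have hm := Finset.mem_Icc.1 hm
    refine ⟨⟨u, m, v, rfl, fun x h => (hu x h).1, fun x h => (hv x h).1,
      fun x h => ⟨b, hb, Nat.le_of_lt_succ (hu x h).2⟩, hPu, hQv⟩, ?_, by simp [hb]⟩
    intro x h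
    simp only [List.mem_append, List.mem_cons] at h
    rcases h with h | rfl | h
    · have := hu x h
      omega
    · exact hm
    · have := hv x h
      omega

/-- The root is forced to be `a`, so the index is the least letter of `v`; `MinCond` says that all
letters of `u` exceed it. -/
theorem wordsWith_isNode_min {P Q : List ℕ → Prop} (hQ : ¬ Q []) (a b : ℕ) (hab : a ≤ b) :
    wordsWith (IsNode MinCond P Q) a b a = {w | ∃ m ∈ Finset.Icc a b,
      ∃ u ∈ wordsIn P (m + 1) (b + 1), ∃ v ∈ wordsWith Q m b m, w = u ++ a :: v} := by
  ext w
  constructor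
  · rintro ⟨⟨u, m, v, rfl, hu, hv, hC, hPu, hQv⟩, hx, ha⟩
    obtain rfl : m = a := by
      refine le_antisymm ?_ (hx m (by simp)).1
      simp only [List.mem_append, List.mem_cons] at ha
      rcases ha with h | h | h
      · exact (hu a h).le
      · exact h.ge
      · exact hv a h
    obtain ⟨k, hk, hle⟩ := exists_min_mem (v := v) (by rintro rfl; exact hQ hQv)
    refine ⟨k, by simpa using hx k (by simp [hk]), u, ⟨hPu, fun x h => ?_⟩, v,
      ⟨hQv, fun x h => ⟨hle x h, (hx x (by simp [h])).2⟩, hk⟩, rfl⟩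
    obtain ⟨M, hM, hMx⟩ := hC x h
    have := hle M hM
    have := hx x (by simp [h])
    omega
  · rintro ⟨m, hm, u, ⟨hPu, hu⟩, v, ⟨hQv, hv, hb⟩, rfl⟩
    have hm := Finset.mem_Icc.1 hm
    refine ⟨⟨u, a, v, rfl, fun x h => ?_, fun x h => hm.1.trans (hv x h).1,
      fun x h => ⟨m, hb, (hu x h).1⟩, hPu, hQv⟩, ?_, by simp⟩
    · have := hu x h
      omega
    · intro x h
      simp only [List.mem_append, List.mem_cons] at h
      rcases h with h | rfl | h
      · have := hu x h
        omega
      · omega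
      · have := hv x h
        omega

theorem IsNode.length_eq {α : Type*} [LinearOrder α] {C : List α → List α → Prop}
    {P Q : List α → Prop} {n k : ℕ} (hP : ∀ u, P u → u.length = n) (hQ : ∀ v, Q v → v.length = k)
    {w : List α} (h : IsNode C P Q w) : w.length = n + k + 1 := by
  obtain ⟨u, m, v, rfl, -, -, -, h1, h2⟩ := h
  simp [hP u h1, hQ v h2, add_assoc]

theorem WeakAndreI.length_eq {α : Type*} [LinearOrder α] (T : BinaryTree Unit) (w : List α)
    (h : WeakAndreI T w) : w.length = T.numNodes := by
  induction T generalizing w with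
  | nil => simp [show w = [] from h]
  | node _ l r ihl ihr => exact IsNode.length_eq ihl ihr h

theorem WeakAndreII.length_eq {α : Type*} [LinearOrder α] (T : BinaryTree Unit) (w : List α)
    (h : WeakAndreII T w) : w.length = T.numNodes := by
  induction T generalizing w with
  | nil => simp [show w = [] from h]
  | node _ l r ihl ihr => exact IsNode.length_eq ihl ihr h

theorem WeakSimsun.length_eq {α : Type*} [LinearOrder α] (T : BinaryTree Unit) (w : List α)
    (h : WeakSimsun T w) : w.length = T.numNodes := by
  induction T generalizing w with
  | nil => simp [show w = [] from h]
  | node _ l r ihl ihr => exact IsNode.length_eq (WeakAndreII.length_eq l) ihr h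

theorem not_nil_of_length {W : List ℕ → Prop} {T : BinaryTree Unit}
    (hW : ∀ w, W w → w.length = T.numNodes) (hT : T ≠ .nil) : ¬ W [] := by
  intro h
  cases T with
  | nil => exact hT rfl
  | node _ l r => simpa using hW [] h

theorem ncard_wordsIn_nil (a b : ℕ) : (wordsIn (fun w => w = []) a b).ncard = 1 := by
  rw [Set.ncard_eq_one]
  refine ⟨[], ?_⟩
  ext w
  simp only [wordsIn, Set.mem_ofPred_eq, Set.mem_singleton_iff, and_iff_left_iff_imp]
  rintro rfl
  simp

theorem wordsWith_isNode_leaf {C : List ℕ → List ℕ → Prop} (hC : C [] []) {a b k : ℕ}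
    (hak : a ≤ k) (hkb : k ≤ b) :
    (wordsWith (IsNode C (fun w => w = []) (fun w => w = [])) a b k).ncard = 1 := by
  rw [Set.ncard_eq_one]
  refine ⟨[k], ?_⟩
  ext w
  constructor
  · rintro ⟨⟨u, m, v, rfl, -, -, -, rfl, rfl⟩, -, h⟩
    obtain rfl : k = m := by simpa using h
    rfl
  · rintro rfl
    exact ⟨⟨[], k, [], by simp [hC]⟩, by simp [hak, hkb], by simp⟩

theorem extremeCount_node {l r : BinaryTree Unit} (hr : r ≠ .nil) (d : ℕ) :
    extremeCount (.node () l r) d =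
      ∑ e ∈ Finset.range (d + 1), wordCount l e * extremeCount r e := by
  rw [extremeCount, if_neg hr]
  rfl

theorem extremeCount_leaf (l : BinaryTree Unit) (d : ℕ) :
    extremeCount (.node () l .nil) d = 1 := by
  rw [extremeCount, if_pos rfl]

theorem ncard_wordsWith_max_node {P Q : List ℕ → Prop} {l r : BinaryTree Unit} (hr : r ≠ .nil)
    (hPlen : ∀ w, P w → w.length = l.numNodes) (hQlen : ∀ w, Q w → w.length = r.numNodes)
    (hP : ∀ a b, (wordsIn P a b).ncard = wordCount l (b - a))
    (hQ : ∀ a b, a ≤ b → (wordsWith Q a b b).ncard = extremeCount r (b - a)) {a b : ℕ}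
    (hab : a ≤ b) :
    (wordsWith (IsNode MaxCond P Q) a b b).ncard = extremeCount (.node () l r) (b - a) := by
  rw [wordsWith_isNode_max (not_nil_of_length hQlen hr),
    ncard_concat _ (fun m => m) _ _ _ (fun m => finite_wordsIn hPlen _ _)
      (fun m => finite_wordsWith hQlen _ _ _) (fun m u hu => hPlen u hu.1) (by tauto),
    extremeCount_node hr, ← sum_Icc_sub _ hab]
  refine Finset.sum_congr rfl fun m hm => ?_
  rw [hP, hQ m b (Finset.mem_Icc.1 hm).2, Nat.add_sub_add_right]

theorem ncard_wordsWith_min_node {P Q : List ℕ → Prop} {l r : BinaryTree Unit} (hr : r ≠ .nil)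
    (hPlen : ∀ w, P w → w.length = l.numNodes) (hQlen : ∀ w, Q w → w.length = r.numNodes)
    (hP : ∀ a b, (wordsIn P a b).ncard = wordCount l (b - a))
    (hQ : ∀ a b, a ≤ b → (wordsWith Q a b a).ncard = extremeCount r (b - a)) {a b : ℕ}
    (hab : a ≤ b) :
    (wordsWith (IsNode MinCond P Q) a b a).ncard = extremeCount (.node () l r) (b - a) := by
  rw [wordsWith_isNode_min (not_nil_of_length hQlen hr) a b hab,
    ncard_concat _ (fun _ => a) _ _ _ (fun m => finite_wordsIn hPlen _ _)
      (fun m => finite_wordsWith hQlen _ _ _) (fun m u hu => hPlen u hu.1),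
    extremeCount_node hr, ← sum_Icc_sub _ hab]
  · refine Finset.sum_congr rfl fun m hm => ?_
    rw [hP, hQ m b (Finset.mem_Icc.1 hm).2, Nat.add_sub_add_right]
  · rintro m - m' - - v ⟨-, h1, h2⟩ ⟨-, h3, h4⟩
    exact le_antisymm (h1 m' h4).1 (h3 m h2).1

theorem ncard_wordsWith_weakAndreI {T : BinaryTree Unit} (hT : NoOnlyLeftChild T) (hne : T ≠ .nil)
    {a b : ℕ} (hab : a ≤ b) : (wordsWith (WeakAndreI T) a b b).ncard = extremeCount T (b - a) := by
  induction T generalizing a b with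
  | nil => exact absurd rfl hne
  | node _ l r ihl ihr =>
    obtain ⟨hlr, hl, hr⟩ := hT
    rcases eq_or_ne r .nil with rfl | hrne
    -- This is where the shape hypothesis enters: a vertex without right child is a leaf, whose only
    -- admissible word is `[b]`.
    · obtain rfl := hlr rfl
      rw [extremeCount_leaf]
      exact wordsWith_isNode_leaf (by simp [MaxCond]) hab le_rfl
    · refine ncard_wordsWith_max_node hrne (WeakAndreI.length_eq l) (WeakAndreI.length_eq r) ?_
        (fun a b hab => ihr hr hrne hab) hab
      intro a b
      rcases eq_or_ne l .nil with rfl | hlne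
      · exact ncard_wordsIn_nil a b
      · rw [wordCount, if_neg hlne]
        exact ncard_wordsIn_of_max (WeakAndreI.length_eq l)
          (not_nil_of_length (WeakAndreI.length_eq l) hlne) (fun a b hab => ihl hl hlne hab) a b

theorem ncard_wordsWith_weakAndreII {T : BinaryTree Unit} (hT : NoOnlyLeftChild T) (hne : T ≠ .nil)
    {a b : ℕ} (hab : a ≤ b) : (wordsWith (WeakAndreII T) a b a).ncard = extremeCount T (b - a) := by
  induction T generalizing a b with
  | nil => exact absurd rfl hne
  | node _ l r ihl ihr =>
    obtain ⟨hlr, hl, hr⟩ := hT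
    rcases eq_or_ne r .nil with rfl | hrne
    · obtain rfl := hlr rfl
      rw [extremeCount_leaf]
      exact wordsWith_isNode_leaf (by simp [MinCond]) le_rfl hab
    · refine ncard_wordsWith_min_node hrne (WeakAndreII.length_eq l) (WeakAndreII.length_eq r) ?_
        (fun a b hab => ihr hr hrne hab) hab
      intro a b
      rcases eq_or_ne l .nil with rfl | hlne
      · exact ncard_wordsIn_nil a b
      · rw [wordCount, if_neg hlne]
        exact ncard_wordsIn_of_min (WeakAndreII.length_eq l)
          (not_nil_of_length (WeakAndreII.length_eq l) hlne) (fun a b hab => ihl hl hlne hab) a b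

theorem ncard_wordsIn_weakAndreI {T : BinaryTree Unit} (hT : NoOnlyLeftChild T) (a b : ℕ) :
    (wordsIn (WeakAndreI T) a b).ncard = wordCount T (b - a) := by
  rcases eq_or_ne T .nil with rfl | hne
  · exact ncard_wordsIn_nil a b
  · rw [wordCount, if_neg hne]
    exact ncard_wordsIn_of_max (WeakAndreI.length_eq T)
      (not_nil_of_length (WeakAndreI.length_eq T) hne)
      (fun a b hab => ncard_wordsWith_weakAndreI hT hne hab) a b

theorem ncard_wordsIn_weakAndreII {T : BinaryTree Unit} (hT : NoOnlyLeftChild T) (a b : ℕ) :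
    (wordsIn (WeakAndreII T) a b).ncard = wordCount T (b - a) := by
  rcases eq_or_ne T .nil with rfl | hne
  · exact ncard_wordsIn_nil a b
  · rw [wordCount, if_neg hne]
    exact ncard_wordsIn_of_min (WeakAndreII.length_eq T)
      (not_nil_of_length (WeakAndreII.length_eq T) hne)
      (fun a b hab => ncard_wordsWith_weakAndreII hT hne hab) a b

/-- The induction runs along the right branch only; the left subtrees contribute the André II count
already known. -/
theorem ncard_wordsWith_weakSimsun {T : BinaryTree Unit} (hT : NoOnlyLeftChild T) (hne : T ≠ .nil)
    {a b : ℕ} (hab : a ≤ b) : (wordsWith (WeakSimsun T) a b b).ncard = extremeCount T (b - a) := by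
  induction T generalizing a b with
  | nil => exact absurd rfl hne
  | node _ l r _ ihr =>
    obtain ⟨hlr, hl, hr⟩ := hT
    rcases eq_or_ne r .nil with rfl | hrne
    · obtain rfl := hlr rfl
      rw [extremeCount_leaf]
      exact wordsWith_isNode_leaf (by simp [MaxCond]) hab le_rfl
    · exact ncard_wordsWith_max_node hrne (WeakAndreII.length_eq l) (WeakSimsun.length_eq r)
        (ncard_wordsIn_weakAndreII hl) (fun a b hab => ihr hr hrne hab) hab

theorem ncard_wordsIn_weakSimsun {T : BinaryTree Unit} (hT : NoOnlyLeftChild T) (a b : ℕ) :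
    (wordsIn (WeakSimsun T) a b).ncard = wordCount T (b - a) := by
  rcases eq_or_ne T .nil with rfl | hne
  · exact ncard_wordsIn_nil a b
  · rw [wordCount, if_neg hne]
    exact ncard_wordsIn_of_max (WeakSimsun.length_eq T)
      (not_nil_of_length (WeakSimsun.length_eq T) hne)
      (fun a b hab => ncard_wordsWith_weakSimsun hT hne hab) a b

end Counting

/-! ### Standardization and inverse descents -/

section Standardization

theorem perm_inv_apply_self {ι : Type*} (π : Equiv.Perm ι) (x : ι) : π⁻¹ (π x) = x :=
  π.symm_apply_apply x

theorem perm_apply_inv_self {ι : Type*} (π : Equiv.Perm ι) (x : ι) : π (π⁻¹ x) = x :=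
  π.apply_symm_apply x

variable {k : ℕ}

/-- The descent indicator of `π` at `i`. -/
def descentAt (π : Equiv.Perm (Fin (k + 1))) (i : Fin k) : ℕ :=
  if π i.succ < π i.castSucc then 1 else 0

/-- The number of descents of `π` before position `i`. -/
def descentsBefore (π : Equiv.Perm (Fin (k + 1))) (i : Fin (k + 1)) : ℕ :=
  ∑ j : Fin k, if j.castSucc < i then descentAt π j else 0

theorem descentsBefore_succ (π : Equiv.Perm (Fin (k + 1))) (i : Fin k) :
    descentsBefore π i.succ = descentsBefore π i.castSucc + descentAt π i := by
  unfold descentsBefore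
  have h : descentAt π i = ∑ j : Fin k, if j = i then descentAt π j else 0 := by simp
  rw [h, ← Finset.sum_add_distrib]
  refine Finset.sum_congr rfl fun j _ => ?_
  rcases lt_trichotomy j i with h | rfl | h
  · simp [h, h.le, h.ne]
  · simp
  · simp [h.ne', h.not_gt, h.not_ge]

theorem descentsBefore_zero (π : Equiv.Perm (Fin (k + 1))) : descentsBefore π 0 = 0 := by
  simp [descentsBefore]

theorem descentsBefore_last (π : Equiv.Perm (Fin (k + 1))) :
    descentsBefore π (Fin.last k) = des π := by
  simp only [descentsBefore, Fin.castSucc_lt_last, if_true, descentAt, des, Finset.card_filter]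
  rw [Fin.sum_univ_castSucc]
  simp [Fin.succ]

theorem descentsBefore_le (π : Equiv.Perm (Fin (k + 1))) (x : Fin (k + 1)) :
    descentsBefore π x ≤ des π := by
  induction x using Fin.reverseInduction with
  | last => exact (descentsBefore_last π).le
  | cast i ih =>
    rw [descentsBefore_succ] at ih
    omega

/-- Sorting breaks ties by position, so `w ∘ π` must increase weakly, and strictly at the descents
of `π`. -/
theorem sort_eq_iff_step {N : ℕ} (π : Equiv.Perm (Fin (k + 1))) (w : Fin (k + 1) → Fin N) :
    Tuple.sort w = π ↔ ∀ i : Fin k,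
      (w (π i.castSucc) : ℕ) + descentAt π i ≤ w (π i.succ) := by
  rw [eq_comm, Tuple.eq_sort_iff', Fin.strictMono_iff_lt_succ]
  refine forall_congr' fun i => Prod.Lex.toLex_lt_toLex.trans ?_
  have hne : π i.castSucc ≠ π i.succ := fun h => Fin.castSucc_lt_succ.ne (π.injective h)
  rw [Fin.lt_def, Fin.ext_iff]
  unfold descentAt
  split_ifs with h
  · have := h.not_gt
    simp only [this, and_false, or_false]
    omega
  · have := lt_of_le_of_ne (not_lt.1 h) hne
    simp only [this, and_true]
    omega

theorem sort_step_lower {N : ℕ} {π : Equiv.Perm (Fin (k + 1))} {w : Fin (k + 1) → Fin N}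
    (h : Tuple.sort w = π) (x : Fin (k + 1)) : descentsBefore π x ≤ w (π x) := by
  rw [sort_eq_iff_step] at h
  induction x using Fin.induction with
  | zero => simp [descentsBefore_zero]
  | succ i ih =>
    have := h i
    rw [descentsBefore_succ]
    omega

theorem sort_step_upper {N : ℕ} {π : Equiv.Perm (Fin (k + 1))} {w : Fin (k + 1) → Fin N}
    (h : Tuple.sort w = π) (x : Fin (k + 1)) : (w (π x) : ℕ) + des π < N + descentsBefore π x := by
  rw [sort_eq_iff_step] at h
  induction x using Fin.reverseInduction with
  | last =>
    rw [descentsBefore_last]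
    have := (w (π (Fin.last k))).isLt
    omega
  | cast i ih =>
    have := h i
    rw [descentsBefore_succ] at ih
    omega

/-- The number of weakly increasing words of length `n` over an alphabet with `N` letters. -/
def monotoneCount (n N : ℕ) : ℕ :=
  (Finset.univ.filter fun h : Fin n → Fin N => ∀ i j, i ≤ j → h i ≤ h j).card

/-- Subtracting `descentsBefore π` from `w ∘ π` relaxes the strict steps to weak ones and costs `des
π` letters at the top. The bounds `sort_step_lower` and `sort_step_upper` keep the natural
subtractions honest. -/
theorem card_sort_eq {N : ℕ} (π : Equiv.Perm (Fin (k + 1))) :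
    (Finset.univ.filter fun w : Fin (k + 1) → Fin N => Tuple.sort w = π).card =
      monotoneCount (k + 1) (N - des π) := by
  refine Finset.card_bij'
    (fun w hw x => ⟨w (π x) - descentsBefore π x, ?_⟩)
    (fun h _ y => ⟨h (π⁻¹ y) + descentsBefore π (π⁻¹ y), ?_⟩) ?_ ?_ ?_ ?_
  · have := sort_step_upper (Finset.mem_filter.1 hw).2 x
    have := sort_step_lower (Finset.mem_filter.1 hw).2 x
    have := descentsBefore_le π x
    omega
  · have := (h (π⁻¹ y)).isLt
    have := descentsBefore_le π (π⁻¹ y)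
    omega
  · intro w hw
    have hw := (Finset.mem_filter.1 hw).2
    refine Finset.mem_filter.2 ⟨Finset.mem_univ _, ?_⟩
    refine Fin.monotone_iff_le_succ.2 fun i => ?_
    have h1 := (sort_eq_iff_step π w).1 hw i
    have h2 := sort_step_lower hw i.castSucc
    rw [Fin.le_def]
    simp only [descentsBefore_succ]
    omega
  · intro h hh
    have hh : Monotone h := (Finset.mem_filter.1 hh).2
    refine Finset.mem_filter.2 ⟨Finset.mem_univ _, (sort_eq_iff_step _ _).2 fun i => ?_⟩
    have h1 := Fin.le_def.1 (hh (Fin.castSucc_lt_succ (i := i)).le)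
    simp only [perm_inv_apply_self, descentsBefore_succ]
    omega
  · intro w hw
    funext y
    have := sort_step_lower (Finset.mem_filter.1 hw).2 (π⁻¹ y)
    simp only [perm_apply_inv_self] at this ⊢
    ext
    simp only
    omega
  · intro h hh
    funext x
    simp

theorem monotoneCount_zero : monotoneCount (k + 1) 0 = 0 := by
  simp [monotoneCount]

theorem monotoneCount_one (n : ℕ) : monotoneCount n 1 = 1 := by
  simp [monotoneCount, Finset.filter_true_of_mem]

theorem sum_eq_sum_fiber {ι : Type*} (S : Finset ι) (f : ι → ℕ) (g : ℕ → ℕ) (d : ℕ)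
    (hg : ∀ e, d < e → g e = 0) :
    ∑ σ ∈ S, g (f σ) = ∑ e ∈ Finset.range (d + 1), (S.filter fun σ => f σ = e).card * g e := by
  simp only [Finset.card_filter, Finset.sum_mul]
  rw [Finset.sum_comm]
  refine Finset.sum_congr rfl fun σ _ => ?_
  simp only [ite_mul, one_mul, zero_mul, Finset.sum_ite_eq, Finset.mem_range]
  split_ifs with h
  · rfl
  · exact hg _ (by omega)

/-- A statistic `f` is determined by the sums of `M (N - f σ)` if `M 0 = 0` and `M 1 = 1`. -/
theorem sum_X_pow_eq_of_sum_eq {ι : Type*} (S S' : Finset ι) (f : ι → ℕ) (M : ℕ → ℕ)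
    (h0 : M 0 = 0) (h1 : M 1 = 1) (h : ∀ N, ∑ σ ∈ S, M (N - f σ) = ∑ σ ∈ S', M (N - f σ)) :
    ∑ σ ∈ S, (X : ℤ[X]) ^ f σ = ∑ σ ∈ S', (X : ℤ[X]) ^ f σ := by
  have key : ∀ d, (S.filter fun σ => f σ = d).card = (S'.filter fun σ => f σ = d).card := by
    intro d
    induction d using Nat.strong_induction_on with
    | _ d ih =>
      -- For `N = d + 1`, values above `d` have weight `M 0 = 0`, the value `d` has weight `M 1 =
      -- 1`, and smaller values cancel by induction.
      have hd := h (d + 1)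
      have hg : ∀ e, d < e → M (d + 1 - e) = 0 := fun e he => by
        rw [Nat.sub_eq_zero_of_le he, h0]
      rw [sum_eq_sum_fiber S f (fun e => M (d + 1 - e)) d hg,
        sum_eq_sum_fiber S' f (fun e => M (d + 1 - e)) d hg, Finset.sum_range_succ,
        Finset.sum_range_succ, Finset.sum_congr rfl fun e he => by rw [ih e (Finset.mem_range.1 he)]]
        at hd
      simpa [h1] using hd
  ext d
  simp only [finsetSum_coeff, coeff_X_pow, Finset.sum_boole, eq_comm (a := d), key d]

/-- Identifies `(Tuple.sort w)⁻¹` as the standardization of `w`. -/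
theorem le_iff_inv_sort_le {n N : ℕ} (w : Fin n → Fin N) {i j : Fin n} (hij : i < j) :
    w i ≤ w j ↔ (Tuple.sort w)⁻¹ i ≤ (Tuple.sort w)⁻¹ j := by
  obtain ⟨hmono, htie⟩ := Tuple.eq_sort_iff.1 (rfl : Tuple.sort w = Tuple.sort w)
  constructor
  · intro h
    by_contra! hlt
    have h1 := hmono hlt.le
    simp only [Function.comp_apply, perm_apply_inv_self] at h1
    have h2 := htie _ _ hlt (by simpa only [perm_apply_inv_self] using le_antisymm h1 h)
    simp only [perm_apply_inv_self] at h2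
    exact absurd h2 hij.not_gt
  · intro h
    simpa only [Function.comp_apply, perm_apply_inv_self] using hmono h

/-- Membership of a word in `W` depends only on its standardization. -/
def StandardizationInvariant (W : List ℕ → Prop) : Prop :=
  ∀ {n : ℕ} (f g : Fin n → ℕ), (∀ i j, i < j → (f i ≤ f j ↔ g i ≤ g j)) →
    W (List.ofFn f) → W (List.ofFn g)

theorem pairwise_finRange {n : ℕ} {r : Fin n → Fin n → Prop} (h : ∀ i j, i < j → r i j) :
    (List.finRange n).Pairwise r :=
  (List.pairwise_lt_finRange n).imp fun {i j} => h i j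

theorem standardizationInvariant_weakAndreI (T : BinaryTree Unit) :
    StandardizationInvariant (WeakAndreI T) := fun f g h hf => by
  rw [List.ofFn_eq_map] at hf ⊢
  exact hf.of_map (pairwise_finRange h)

theorem standardizationInvariant_weakAndreII (T : BinaryTree Unit) :
    StandardizationInvariant (WeakAndreII T) := fun f g h hf => by
  rw [List.ofFn_eq_map] at hf ⊢
  exact hf.of_map (pairwise_finRange h)

theorem standardizationInvariant_weakSimsun (T : BinaryTree Unit) :
    StandardizationInvariant (WeakSimsun T) := fun f g h hf => by
  rw [List.ofFn_eq_map] at hf ⊢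
  exact hf.of_map (pairwise_finRange h)

theorem StandardizationInvariant.ofFn_iff {W : List ℕ → Prop} (hW : StandardizationInvariant W)
    {n N : ℕ} (w : Fin n → Fin N) :
    W (List.ofFn fun i => (w i : ℕ)) ↔ W (word (Tuple.sort w)⁻¹) := by
  have h : ∀ i j, i < j → ((w i : ℕ) ≤ w j ↔
      ((Tuple.sort w)⁻¹ i : ℕ) + 1 ≤ ((Tuple.sort w)⁻¹ j : ℕ) + 1) := by
    intro i j hij
    rw [Nat.add_le_add_iff_right]
    exact le_iff_inv_sort_le w hij
  exact ⟨hW _ _ h, hW _ _ fun i j hij => (h i j hij).symm⟩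

theorem ncard_wordsIn_eq_card {W : List ℕ → Prop} [DecidablePred W] {n : ℕ}
    (hlen : ∀ w, W w → w.length = n) (N : ℕ) : (wordsIn W 0 N).ncard =
      (Finset.univ.filter fun w : Fin n → Fin N => W (List.ofFn fun i => (w i : ℕ))).card := by
  rw [← Set.ncard_coe_finset,
    ← Set.ncard_image_of_injective (f := fun w : Fin n → Fin N => List.ofFn fun i => (w i : ℕ))]
  · congr 1
    ext w
    simp only [Finset.coe_filter, Finset.mem_univ, true_and, Set.mem_image, Set.mem_ofPred_eq]
    constructor
    · rintro ⟨hw, hb⟩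
      obtain rfl := hlen w hw
      have : List.ofFn (fun i : Fin w.length => w.get i) = w := List.ofFn_get w
      exact ⟨fun i => ⟨w.get i, (hb _ (List.get_mem w i)).2⟩, by simpa using hw, by simp⟩
    · rintro ⟨v, hv, rfl⟩
      refine ⟨hv, fun x hx => ?_⟩
      obtain ⟨i, rfl⟩ := List.mem_ofFn.1 hx
      exact ⟨Nat.zero_le _, (v i).isLt⟩
  · intro v v' h
    have := List.ofFn_injective h
    funext i
    exact Fin.ext (congrFun this i)

/-- Words are grouped by standardization `σ`. The sorting permutation is `σ⁻¹`, which is why inverse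
descents appear. -/
theorem sum_monotoneCount_eq {W : List ℕ → Prop} [DecidablePred W]
    (hW : StandardizationInvariant W) (hlen : ∀ w, W w → w.length = k + 1) (N : ℕ) :
    ∑ σ ∈ Finset.univ.filter (fun σ : Equiv.Perm (Fin (k + 1)) => W (word σ)),
      monotoneCount (k + 1) (N - ides σ) = (wordsIn W 0 N).ncard := by
  rw [ncard_wordsIn_eq_card hlen, Finset.card_eq_sum_card_fiberwise
    (f := fun w : Fin (k + 1) → Fin N => (Tuple.sort w)⁻¹)
    (t := Finset.univ.filter fun σ : Equiv.Perm (Fin (k + 1)) => W (word σ))]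
  · refine Finset.sum_congr rfl fun σ hσ => ?_
    rw [ides, ← card_sort_eq, Finset.filter_filter]
    congr 1
    refine Finset.filter_congr fun w _ => ?_
    rw [hW.ofFn_iff, inv_eq_iff_eq_inv]
    refine ⟨?_, And.right⟩
    intro h
    refine ⟨?_, h⟩
    rw [h, inv_inv]
    exact (Finset.mem_filter.1 hσ).2
  · intro w hw
    simpa [← hW.ofFn_iff] using hw

theorem sum_X_pow_ides_eq {W W' : List ℕ → Prop} [DecidablePred W] [DecidablePred W']
    (hW : StandardizationInvariant W) (hW' : StandardizationInvariant W')
    (hlen : ∀ w, W w → w.length = k + 1) (hlen' : ∀ w, W' w → w.length = k + 1)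
    (h : ∀ N, (wordsIn W 0 N).ncard = (wordsIn W' 0 N).ncard) :
    ∑ σ ∈ Finset.univ.filter (fun σ : Equiv.Perm (Fin (k + 1)) => W (word σ)),
        (X : ℤ[X]) ^ ides σ =
      ∑ σ ∈ Finset.univ.filter (fun σ : Equiv.Perm (Fin (k + 1)) => W' (word σ)),
        (X : ℤ[X]) ^ ides σ :=
  sum_X_pow_eq_of_sum_eq _ _ _ (monotoneCount (k + 1)) monotoneCount_zero (monotoneCount_one _)
    fun N => by rw [sum_monotoneCount_eq hW hlen, sum_monotoneCount_eq hW' hlen', h]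

/-! ### Return to permutations -/

theorem nodup_word {n : ℕ} (σ : Equiv.Perm (Fin n)) : (word σ).Nodup := by
  rw [word, List.nodup_ofFn]
  intro i j h
  exact σ.injective (Fin.ext (by simpa using h))

theorem mem_word {n : ℕ} (σ : Equiv.Perm (Fin n)) (x : ℕ) : x ∈ word σ ↔ 1 ≤ x ∧ x ≤ n := by
  rw [word, List.mem_ofFn]
  constructor
  · rintro ⟨i, rfl⟩
    omega
  · rintro ⟨h1, h2⟩
    exact ⟨σ⁻¹ ⟨x - 1, by omega⟩, by simp; omega⟩

/-- Cutoffs beyond `n` give the whole word again. For `n = 0` the equivalence fails, as `LastIsMax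
[]` holds vacuously. -/
theorem isSimsun_word_iff {n : ℕ} (hn : 1 ≤ n) (σ : Equiv.Perm (Fin n)) :
    IsSimsun n (word σ) ↔ LastIsMax (word σ) ∧ NestedNoDoubleDescent (word σ) [] := by
  have hne : word σ ≠ [] := List.ne_nil_of_mem ((mem_word σ n).2 ⟨hn, le_rfl⟩)
  refine and_congr ?_ ?_
  · rw [LastIsMax, List.getLast?_eq_some_getLast hne]
    simp only [Option.some.injEq, Option.mem_some_iff, forall_eq']
    constructor
    · intro h x hx
      rw [h]
      exact ((mem_word σ x).1 hx).2
    · intro h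
      exact le_antisymm ((mem_word σ _).1 (List.getLast_mem hne)).2
        (h n ((mem_word σ n).2 ⟨hn, le_rfl⟩))
  · simp only [NestedNoDoubleDescent, List.append_nil]
    refine ⟨fun h j => ?_, fun h j _ => h j⟩
    rcases le_total j n with hj | hj
    · exact h j hj
    · convert h n le_rfl using 1
      refine List.filter_congr fun x hx => ?_
      have := ((mem_word σ x).1 hx).2
      simp [this, this.trans hj]

open scoped Classical in
theorem andI_eq_filter (n : ℕ) (T : BinaryTree Unit) :
    AndI n T = Finset.univ.filter fun σ => WeakAndreI T (word σ) :=
  Finset.filter_congr fun σ _ => (weakAndreI_iff (nodup_word σ)).symm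

open scoped Classical in
theorem andII_eq_filter (n : ℕ) (T : BinaryTree Unit) :
    AndII n T = Finset.univ.filter fun σ => WeakAndreII T (word σ) :=
  Finset.filter_congr fun σ _ => (weakAndreII_iff (nodup_word σ)).symm

open scoped Classical in
theorem rs_eq_filter {n : ℕ} (hn : 1 ≤ n) (T : BinaryTree Unit) :
    RS n T = Finset.univ.filter fun σ => WeakSimsun T (word σ) :=
  Finset.filter_congr fun σ _ => by
    rw [weakSimsun_iff (nodup_word σ), isSimsun_word_iff hn, treeShape]

end Standardization

end AndreSimsun

theorem theorem2p4 (n : ℕ) (hn : 1 ≤ n) (T : BinaryTree Unit) (hT : T ∈ AndreSimsun.URL n) :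
    (∑ σ ∈ AndreSimsun.AndI n T, (X : ℤ[X]) ^ AndreSimsun.ides σ =
      ∑ σ ∈ AndreSimsun.AndII n T, (X : ℤ[X]) ^ AndreSimsun.ides σ) ∧
    (∑ σ ∈ AndreSimsun.AndII n T, (X : ℤ[X]) ^ AndreSimsun.ides σ =
      ∑ σ ∈ AndreSimsun.RS n T, (X : ℤ[X]) ^ AndreSimsun.ides σ) := by
  classical
  obtain ⟨hnodes, hT⟩ := hT
  rw [AndreSimsun.andI_eq_filter, AndreSimsun.andII_eq_filter, AndreSimsun.rs_eq_filter hn]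
  obtain ⟨k, rfl⟩ := Nat.exists_eq_add_of_le' hn
  have hI : ∀ w : List ℕ, AndreSimsun.WeakAndreI T w → w.length = k + 1 :=
    fun w hw => (hw.length_eq).trans hnodes
  have hII : ∀ w : List ℕ, AndreSimsun.WeakAndreII T w → w.length = k + 1 :=
    fun w hw => (hw.length_eq).trans hnodes
  have hS : ∀ w : List ℕ, AndreSimsun.WeakSimsun T w → w.length = k + 1 :=
    fun w hw => (hw.length_eq).trans hnodes
  constructor
  · refine AndreSimsun.sum_X_pow_ides_eq (AndreSimsun.standardizationInvariant_weakAndreI T)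
      (AndreSimsun.standardizationInvariant_weakAndreII T) hI hII fun N => ?_
    rw [AndreSimsun.ncard_wordsIn_weakAndreI hT, AndreSimsun.ncard_wordsIn_weakAndreII hT]
  · refine AndreSimsun.sum_X_pow_ides_eq (AndreSimsun.standardizationInvariant_weakAndreII T)
      (AndreSimsun.standardizationInvariant_weakSimsun T) hII hS fun N => ?_
    rw [AndreSimsun.ncard_wordsIn_weakAndreII hT, AndreSimsun.ncard_wordsIn_weakSimsun hT]
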